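/- For a string $S$ over $\{a,b\}$ let $\overline{S}$ be the string obtained by exchanging $a$ and $b$. Let $T_1 := a$ and $T_i := T_{i-1}\,\overline{T_{i-1}}$ for $i \ge 2$ be the Thue–Morse words. An occurrence in a text $T$ of length $n$ is a pair of positions $(s,e)$ with $1 \le s \le e \le n$; it is an occurrence of the string $T[s \ldots e]$. A string is repeated in $T$ if it has at least two occurrences in $T$, and unique if it has exactly one. An occurrence $(s,e)$ is a net occurrence in $T$ if $T[s \ldots e]$ is repeated, while the left extension $T[s-1 \ldots e]$ and the right extension $T[s \ldots e+1]$ are both unique; when $s=1$ the left extension, and when $e=n$ the right extension, is by convention considered unique. Theorem. For each $i \ge 5$, the net occurrences in $T_i$ are exactly the occurrences in $T_i$ of the four strings $T_{i-2}$, $\overline{T_{i-2}}$, $T_{i-4}\,\overline{T_{i-3}}$ and $\overline{T_{i-4}}\,T_{i-3}$. These have exactly three, two, two and two occurrences in $T_i$, respectively, and $T_i$ has exactly nine net occurrences. -/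

import Mathlib

namespace NetOcc

/-- Strings over the binary alphabet `{a, b}`, with `a = false` and `b = true`. -/
abbrev Word := List Bool

/-- The substring `T[i … j]`, with 1-based inclusive positions. -/
def substr (T : Word) (i j : ℕ) : Word := (T.drop (i - 1)).take (j + 1 - i)

/-- `p = (i, j)` is an occurrence in `T`: a starting and an ending position in `T`. -/
def IsOcc (T : Word) (p : ℕ × ℕ) : Prop := 1 ≤ p.1 ∧ p.1 ≤ p.2 ∧ p.2 ≤ T.length

/-- The set of the occurrences of the string `S` in `T`. -/
def occs (T S : Word) : Set (ℕ × ℕ) := {p | IsOcc T p ∧ substr T p.1 p.2 = S}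

/-- `S` has at least two occurrences in `T`. -/
def IsRepeated (T S : Word) : Prop := ∃ p ∈ occs T S, ∃ q ∈ occs T S, p ≠ q

/-- `S` has exactly one occurrence in `T`. -/
def IsUnique (T S : Word) : Prop := ∃! p, p ∈ occs T S

/-- `(i, j)` is a net occurrence in `T`: the string `T[i … j]` is repeated, while the left
extension `T[i-1 … j]` and the right extension `T[i … j+1]` are unique; an extension that would
leave the text counts as unique. -/
def IsNetOcc (T : Word) (p : ℕ × ℕ) : Prop :=
  IsOcc T p ∧ IsRepeated T (substr T p.1 p.2) ∧
    (p.1 = 1 ∨ IsUnique T (substr T (p.1 - 1) p.2)) ∧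
    (p.2 = T.length ∨ IsUnique T (substr T p.1 (p.2 + 1)))

/-- The complement of a binary string: exchange `a` and `b`. -/
def comp (S : Word) : Word := S.map Bool.not

/-- The Thue–Morse word of order `i ≥ 1` (the value at `0` is a placeholder). -/
def tm : ℕ → Word
  | 0 => []
  | 1 => [false]
  | n + 2 => tm (n + 1) ++ comp (tm (n + 1))

end NetOcc

namespace NetOcc

/-! `tm (k + 5)` is the prefix of length `2 ^ k * 16` of the infinite Thue–Morse word, which is
fixed by the doubling morphism a ↦ ab, b ↦ ba. Equal factors of length at least 4 start at positions
of the same parity (`Match.sync`). So a repeated factor that cuts a two-letter block extends across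
the cut and stays repeated, and is not a net occurrence. Hence the net occurrences in a prefix of
length `2 * n` are exactly the doubled net occurrences of the prefix of length `n` (`net_two_mul`).
Iteration reduces everything to the 16 letters of `tm 5`, where it is a finite computation;
`match_pow` does the same for the occurrences of the four strings. -/

/-- The infinite Thue–Morse word: the parity of the binary digit sum. -/
def letter (n : ℕ) : Bool := (Nat.digits 2 n).sum % 2 == 1

theorem letter_two_mul (n : ℕ) : letter (2 * n) = letter n := by
  rcases Nat.eq_zero_or_pos n with rfl | h
  · rfl
  · have := Nat.digits_add_two_add_one 0 (2 * n - 1)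
    rw [show 2 * n - 1 + 1 = 2 * n by omega] at this
    simp [letter, this]

theorem letter_two_mul_add_one (n : ℕ) : letter (2 * n + 1) = !letter n := by
  have := Nat.digits_add_two_add_one 0 (2 * n)
  simp only [letter]
  rw [show 0 + 2 = 2 from rfl] at this
  rw [this, show (2 * n + 1) / 2 = n by omega, show (2 * n + 1) % 2 = 1 by omega, List.sum_cons]
  rcases Nat.mod_two_eq_zero_or_one (Nat.digits 2 n).sum with h | h
  · rw [h, show (1 + (Nat.digits 2 n).sum) % 2 = 1 by omega]; rfl
  · rw [h, show (1 + (Nat.digits 2 n).sum) % 2 = 0 by omega]; rfl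

/-- The factors of length `l` of the infinite word at `s` and at `r` agree. -/
def Match (s r l : ℕ) : Prop := ∀ k < l, letter (s + k) = letter (r + k)

instance (s r l : ℕ) : Decidable (Match s r l) := by unfold Match; infer_instance

/-- The factor of length `l` at `s` occurs elsewhere in the prefix of length `n`. -/
def Rep (n s l : ℕ) : Prop := ∃ r ≤ n, r ≠ s ∧ r + l ≤ n ∧ Match s r l

instance (n s l : ℕ) : Decidable (Rep n s l) :=
  decidable_of_iff (∃ r < n + 1, r ≠ s ∧ r + l ≤ n ∧ Match s r l)
    (by simp only [Rep, Nat.lt_succ_iff])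

/-- The factor of length `l` at `s` is a net occurrence in the prefix of length `n`. -/
def Net (n s l : ℕ) : Prop :=
  (0 < l ∧ s + l ≤ n) ∧ Rep n s l ∧ (s = 0 ∨ ¬ Rep n (s - 1) (l + 1)) ∧
    (s + l = n ∨ ¬ Rep n s (l + 1))

instance (n s l : ℕ) : Decidable (Net n s l) := by unfold Net; infer_instance

/-- All factors of length at most `3` of the prefix of length `n` are repeated in it. -/
def ShortRep (n : ℕ) : Prop := ∀ s l, l ≤ 3 → s + l ≤ n → Rep n s l

/-! ### Synchronisation of matches with the two-letter blocks -/

theorem Match.mono {s r l a m : ℕ} (h : Match s r l) (hm : a + m ≤ l) :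
    Match (s + a) (r + a) m := fun k hk => by
  simpa only [add_assoc] using h (a + k) (by omega)

theorem match_double {s r l : ℕ} : Match (2 * s) (2 * r) (2 * l) ↔ Match s r l := by
  constructor
  · intro h k hk
    have := h (2 * k) (by omega)
    rwa [← mul_add, ← mul_add, letter_two_mul, letter_two_mul] at this
  · intro h k hk
    obtain ⟨j, rfl | rfl⟩ := Nat.even_or_odd' k
    · rw [← mul_add, ← mul_add, letter_two_mul, letter_two_mul]
      exact h j (by omega)
    · rw [← add_assoc, ← add_assoc, ← mul_add, ← mul_add, letter_two_mul_add_one,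
        letter_two_mul_add_one, h j (by omega)]

/-- A match of opposite parities would force three equal consecutive letters, two of which form a
block ab or ba. -/
theorem match_sync_aux {s r : ℕ} (h : Match (2 * s) (2 * r + 1) 4) : False := by
  have h0 := h 0 (by omega)
  have h1 := h 1 (by omega)
  have h2 := h 2 (by omega)
  have h3 := h 3 (by omega)
  rw [add_zero, add_zero, letter_two_mul, letter_two_mul_add_one] at h0
  rw [letter_two_mul_add_one, show 2 * r + 1 + 1 = 2 * (r + 1) by ring, letter_two_mul] at h1
  rw [show 2 * s + 2 = 2 * (s + 1) by ring, letter_two_mul,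
    show 2 * r + 1 + 2 = 2 * (r + 1) + 1 by ring, letter_two_mul_add_one] at h2
  rw [show 2 * s + 3 = 2 * (s + 1) + 1 by ring, letter_two_mul_add_one,
    show 2 * r + 1 + 3 = 2 * (r + 2) by ring, letter_two_mul] at h3
  have e1 : letter (r + 1) = letter r := by rw [← h1, h0, Bool.not_not]
  have e2 : letter (r + 2) = letter (r + 1) := by rw [← h3, h2, Bool.not_not]
  obtain ⟨j, rfl | rfl⟩ := Nat.even_or_odd' r
  · rw [letter_two_mul_add_one, letter_two_mul] at e1
    exact Bool.not_ne_self _ e1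
  · rw [show 2 * j + 1 + 2 = 2 * (j + 1) + 1 by ring, show 2 * j + 1 + 1 = 2 * (j + 1) by ring,
      letter_two_mul_add_one, letter_two_mul] at e2
    exact Bool.not_ne_self _ e2

theorem Match.sync {s r l : ℕ} (h : Match s r l) (hl : 4 ≤ l) : s % 2 = r % 2 := by
  have h4 : Match s r 4 := h.mono (a := 0) (by omega)
  obtain ⟨a, rfl | rfl⟩ := Nat.even_or_odd' s <;> obtain ⟨b, rfl | rfl⟩ := Nat.even_or_odd' r
  · omega
  · exact (match_sync_aux h4).elim
  · exact (match_sync_aux fun k hk => (h4 k hk).symm).elim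
  · omega

theorem Match.left {s r l : ℕ} (h : Match (2 * s + 1) (2 * r + 1) l) (hl : 0 < l) :
    Match (2 * s) (2 * r) (l + 1) := by
  intro k hk
  rcases k with _ | k
  · have := h 0 hl
    rw [add_zero, add_zero, letter_two_mul_add_one, letter_two_mul_add_one] at this
    simpa [letter_two_mul] using this
  · have := h k (by omega)
    rwa [add_assoc, add_assoc, add_comm 1 k] at this

theorem Match.right {s r l : ℕ} (h : Match s r l) (hl : 0 < l) (hsr : s % 2 = r % 2)
    (ho : (s + l) % 2 = 1) : Match s r (l + 1) := by
  intro k hk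
  rcases Nat.lt_succ_iff_lt_or_eq.1 hk with hk | rfl
  · exact h k hk
  · have := h (k - 1) (by omega)
    obtain ⟨a, ha⟩ : ∃ a, s + k = 2 * a + 1 := ⟨(s + k) / 2, by omega⟩
    obtain ⟨b, hb⟩ : ∃ b, r + k = 2 * b + 1 := ⟨(r + k) / 2, by omega⟩
    rw [show s + (k - 1) = 2 * a by omega, show r + (k - 1) = 2 * b by omega, letter_two_mul,
      letter_two_mul] at this
    rw [ha, hb, letter_two_mul_add_one, letter_two_mul_add_one, this]

/-! ### Repeated factors and net occurrences under doubling -/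

theorem Rep.mono {n s l a m : ℕ} (h : Rep n s l) (hm : a + m ≤ l) : Rep n (s + a) m := by
  obtain ⟨r, -, hne, hr, h⟩ := h
  exact ⟨r + a, by omega, by omega, by omega, h.mono hm⟩

theorem Rep.double {n s l : ℕ} (h : Rep n s l) : Rep (2 * n) (2 * s) (2 * l) := by
  obtain ⟨r, -, hne, hr, h⟩ := h
  exact ⟨2 * r, by omega, by omega, by omega, match_double.2 h⟩

theorem Rep.of_double {n s l : ℕ} (h : Rep (2 * n) (2 * s) (2 * l)) (hl : 2 ≤ l) :
    Rep n s l := by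
  obtain ⟨r, -, hne, hr, h⟩ := h
  have := h.sync (by omega)
  obtain ⟨r, rfl⟩ : ∃ b, r = 2 * b := ⟨r / 2, by omega⟩
  exact ⟨r, by omega, by omega, by omega, match_double.1 h⟩

theorem Rep.left {n s l : ℕ} (h : Rep n (2 * s + 1) l) (hl : 4 ≤ l) :
    Rep n (2 * s) (l + 1) := by
  obtain ⟨r, -, hne, hr, h⟩ := h
  have := h.sync hl
  obtain ⟨r, rfl⟩ : ∃ b, r = 2 * b + 1 := ⟨r / 2, by omega⟩
  exact ⟨2 * r, by omega, by omega, by omega, h.left (by omega)⟩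

theorem Rep.right {n s l : ℕ} (h : Rep (2 * n) s l) (hl : 4 ≤ l) (ho : (s + l) % 2 = 1) :
    Rep (2 * n) s (l + 1) := by
  obtain ⟨r, hrn, hne, hr, h⟩ := h
  have := h.sync hl
  -- `r + l` is odd and the text length even, so the extended copy still fits.
  exact ⟨r, hrn, hne, by omega, h.right (by omega) this ho⟩

theorem ShortRep.four {n : ℕ} (h : ShortRep n) {s l : ℕ} (hl : l ≤ 4) (hs : s + l ≤ 2 * n) :
    Rep (2 * n) s l := by
  -- At most four letters meet at most three blocks, so the factor lies in the image of one of
  -- length at most 3.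
  have := (h (s / 2) ((s + l + 1) / 2 - s / 2) (by omega) (by omega)).double.mono
    (a := s % 2) (m := l) (by omega)
  rwa [Nat.div_add_mod] at this

theorem ShortRep.double {n : ℕ} (h : ShortRep n) : ShortRep (2 * n) :=
  fun _ _ hl hs => h.four (by omega) hs

/-- A shorter net occurrence would have an extension of length at most `m`, which is repeated; `m <
n` ensures that some extension stays inside the text. -/
theorem Net.lt {n s l m : ℕ} (h : Net n s l) (hn : m < n)
    (hm : ∀ s l, l ≤ m → s + l ≤ n → Rep n s l) : m ≤ l := by
  obtain ⟨⟨h0, h1⟩, -, h2, h3⟩ := h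
  by_contra! hl
  by_cases hs : s = 0
  · rcases h3 with h3 | h3
    · omega
    · exact h3 (hm _ _ (by omega) (by omega))
  · exact (h2.resolve_left hs) (hm _ _ (by omega) (by omega))

theorem net_double_iff {n s l : ℕ} (hl : 2 ≤ l) :
    Net (2 * n) (2 * s) (2 * l) ↔ Net n s l := by
  have hleft (hs : s ≠ 0) : Rep (2 * n) (2 * s - 1) (2 * l + 1) ↔ Rep n (s - 1) (l + 1) := by
    obtain ⟨s, rfl⟩ := Nat.exists_eq_succ_of_ne_zero hs
    rw [show 2 * (s + 1) - 1 = 2 * s + 1 by omega, Nat.succ_sub_one]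
    exact ⟨fun H => Rep.of_double (H.left (by omega)) (by omega),
      fun H => H.double.mono (a := 1) (by omega)⟩
  have hright : Rep (2 * n) (2 * s) (2 * l + 1) ↔ Rep n s (l + 1) :=
    ⟨fun H => Rep.of_double (H.right (by omega) (by omega)) (by omega),
      fun H => H.double.mono (a := 0) (by omega)⟩
  have hrep : Rep (2 * n) (2 * s) (2 * l) ↔ Rep n s l :=
    ⟨fun H => H.of_double hl, fun H => H.double⟩
  have hleft' : (2 * s = 0 ∨ ¬ Rep (2 * n) (2 * s - 1) (2 * l + 1)) ↔
      (s = 0 ∨ ¬ Rep n (s - 1) (l + 1)) := by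
    by_cases hs : s = 0
    · simp [hs]
    · simp [hs, hleft hs]
  unfold Net
  rw [hright, hrep, hleft', show 2 * s + 2 * l = 2 * n ↔ s + l = n by omega]
  exact and_congr (by omega) Iff.rfl

theorem net_two_mul {n s l : ℕ} (hn : 4 ≤ n) (h : ShortRep n) :
    Net (2 * n) s l ↔ ∃ a b, s = 2 * a ∧ l = 2 * b ∧ Net n a b := by
  constructor
  · intro H
    have hl : 4 ≤ l := H.lt (by omega) fun s l h1 h2 => h.four h1 h2
    have hs : s % 2 = 0 := by
      by_contra hs
      obtain ⟨a, rfl⟩ : ∃ a, s = 2 * a + 1 := ⟨s / 2, by omega⟩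
      exact (H.2.2.1.resolve_left (by omega)) (H.2.1.left hl)
    have hl2 : l % 2 = 0 := by
      by_contra hl2
      exact (H.2.2.2.resolve_left (by omega)) (H.2.1.right hl (by omega))
    obtain ⟨a, rfl⟩ : ∃ a, s = 2 * a := ⟨s / 2, by omega⟩
    obtain ⟨b, rfl⟩ : ∃ a, l = 2 * a := ⟨l / 2, by omega⟩
    exact ⟨a, b, rfl, rfl, (net_double_iff (by omega)).1 H⟩
  · rintro ⟨a, b, rfl, rfl, H⟩
    have : 3 ≤ b := H.lt (by omega) h
    exact (net_double_iff (by omega)).2 H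

theorem shortRep_sixteen : ShortRep 16 := by
  have : ∀ s < 17, ∀ l < 4, s + l ≤ 16 → Rep 16 s l := by decide +kernel
  exact fun s l hl hs => this s (by omega) l (by omega) hs

theorem shortRep_pow (k : ℕ) : ShortRep (2 ^ k * 16) := by
  induction k with
  | zero => exact shortRep_sixteen
  | succ k ih => rw [pow_succ', mul_assoc]; exact ih.double

theorem net_pow {k s l : ℕ} :
    Net (2 ^ k * 16) s l ↔ ∃ a b, s = 2 ^ k * a ∧ l = 2 ^ k * b ∧ Net 16 a b := by
  induction k generalizing s l with
  | zero => simp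
  | succ k ih =>
    have := Nat.one_le_two_pow (n := k)
    simp only [pow_succ', mul_assoc]
    rw [net_two_mul (by omega) (shortRep_pow k)]
    constructor
    · rintro ⟨a, b, rfl, rfl, H⟩
      obtain ⟨c, d, rfl, rfl, H'⟩ := ih.1 H
      exact ⟨c, d, rfl, rfl, H'⟩
    · rintro ⟨a, b, rfl, rfl, H⟩
      exact ⟨_, _, rfl, rfl, ih.2 ⟨a, b, rfl, rfl, H⟩⟩

/-- All occurrences of a scaled factor are themselves scaled: `2 ≤ l` keeps the length at least 4 at
each halving, as synchronisation requires. -/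
theorem match_pow {k s r l : ℕ} (hl : 2 ≤ l) :
    Match (2 ^ k * s) r (2 ^ k * l) ↔ ∃ a, r = 2 ^ k * a ∧ Match s a l := by
  induction k generalizing r with
  | zero => simp
  | succ k ih =>
    have := Nat.mul_le_mul (Nat.one_le_two_pow (n := k)) hl
    simp only [pow_succ', mul_assoc]
    constructor
    · intro H
      have := H.sync (by omega)
      obtain ⟨b, rfl⟩ : ∃ b, r = 2 * b := ⟨r / 2, by omega⟩
      obtain ⟨a, rfl, H'⟩ := ih.1 (match_double.1 H)
      exact ⟨a, rfl, H'⟩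
    · rintro ⟨a, rfl, H⟩
      exact match_double.2 (ih.2 ⟨a, rfl, H⟩)

/-! ### Translation from 1-based positions to 0-based starts and lengths -/

/-- The factor of length `l` at `s` of the infinite word. -/
def factor (s l : ℕ) : Word := (List.range l).map fun k => letter (s + k)

theorem length_factor (s l : ℕ) : (factor s l).length = l := by simp [factor]

theorem factor_eq_iff {s r l : ℕ} : factor r l = factor s l ↔ Match s r l := by
  simp only [factor, List.map_inj_left, List.mem_range, Match]
  exact forall₂_congr fun _ _ => eq_comm

theorem factor_add (s l m : ℕ) : factor s (l + m) = factor s l ++ factor (s + l) m := by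
  simp [factor, List.range_add, Function.comp_def, add_assoc]

/-- The binary digits of `m` and `j` do not overlap, so their digit sums add. -/
theorem letter_pow_mul_add (k m j : ℕ) (hj : j < 2 ^ k) :
    letter (2 ^ k * m + j) = xor (letter m) (letter j) := by
  induction k generalizing j with
  | zero =>
    obtain rfl : j = 0 := by simpa using hj
    simp [letter]
  | succ k ih =>
    rw [pow_succ'] at hj
    obtain ⟨i, rfl | rfl⟩ := Nat.even_or_odd' j
    · rw [pow_succ', mul_assoc, ← mul_add, letter_two_mul, letter_two_mul, ih i (by omega)]
    · rw [pow_succ', mul_assoc, ← add_assoc, ← mul_add, letter_two_mul_add_one,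
        letter_two_mul_add_one, ih i (by omega), Bool.xor_not]

theorem factor_pow_of_true {k m : ℕ} (h : letter m = true) :
    factor (2 ^ k * m) (2 ^ k) = comp (factor 0 (2 ^ k)) := by
  simp only [factor, comp, List.map_map, List.map_inj_left, List.mem_range, Function.comp_apply]
  intro j hj
  rw [letter_pow_mul_add k m j hj, h, zero_add, Bool.true_xor]

theorem factor_pow_of_false {k m : ℕ} (h : letter m = false) :
    factor (2 ^ k * m) (2 ^ k) = factor 0 (2 ^ k) := by
  simp only [factor, List.map_inj_left, List.mem_range]
  intro j hj
  rw [letter_pow_mul_add k m j hj, h, zero_add, Bool.false_xor]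

theorem tm_succ (k : ℕ) : tm (k + 1) = factor 0 (2 ^ k) := by
  induction k with
  | zero => decide +kernel
  | succ k ih =>
    have := factor_pow_of_true (k := k) (m := 1) (by decide +kernel)
    rw [mul_one] at this
    rw [tm, ih, pow_succ, mul_two, factor_add, zero_add, this]

theorem substr_factor {n s l : ℕ} (h : s + l ≤ n) :
    substr (factor 0 n) (s + 1) (s + l) = factor s l := by
  obtain ⟨m, rfl⟩ := Nat.exists_eq_add_of_le h
  rw [substr, show s + l + 1 - (s + 1) = l by omega, Nat.add_sub_cancel, add_assoc, factor_add,
    List.drop_left' (length_factor _ _), zero_add, factor_add, List.take_left' (length_factor _ _)]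

theorem isOcc_factor_iff {n : ℕ} {p : ℕ × ℕ} :
    IsOcc (factor 0 n) p ↔ ∃ s l, 0 < l ∧ s + l ≤ n ∧ p = (s + 1, s + l) := by
  obtain ⟨x, y⟩ := p
  simp only [IsOcc, length_factor, Prod.mk.injEq]
  constructor
  · rintro ⟨h1, h2, h3⟩
    exact ⟨x - 1, y + 1 - x, by omega, by omega, by omega, by omega⟩
  · rintro ⟨s, l, h1, h2, rfl, rfl⟩
    omega

theorem mem_occs_factor {n s l : ℕ} (hl : 0 < l) {p : ℕ × ℕ} :
    p ∈ occs (factor 0 n) (factor s l) ↔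
      ∃ r, r + l ≤ n ∧ Match s r l ∧ p = (r + 1, r + l) := by
  simp only [occs, Set.mem_ofPred_eq, isOcc_factor_iff]
  constructor
  · rintro ⟨⟨r, m, h1, h2, rfl⟩, h⟩
    rw [substr_factor h2] at h
    obtain rfl : m = l := by simpa [length_factor] using congrArg List.length h
    exact ⟨r, h2, factor_eq_iff.1 h, rfl⟩
  · rintro ⟨r, h1, h2, rfl⟩
    exact ⟨⟨r, l, hl, h1, rfl⟩, by rw [substr_factor h1, factor_eq_iff.2 h2]⟩

theorem isRepeated_factor_iff {n s l : ℕ} (hl : 0 < l) (h : s + l ≤ n) :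
    IsRepeated (factor 0 n) (factor s l) ↔ Rep n s l := by
  simp only [IsRepeated, mem_occs_factor hl]
  constructor
  · rintro ⟨_, ⟨r, h1, h2, rfl⟩, _, ⟨q, h3, h4, rfl⟩, hne⟩
    by_cases hr : r = s
    · exact ⟨q, by omega, fun hq => hne (by rw [hr, hq]), h3, h4⟩
    · exact ⟨r, by omega, hr, h1, h2⟩
  · rintro ⟨r, -, hne, h1, h2⟩
    refine ⟨_, ⟨r, h1, h2, rfl⟩, _, ⟨s, h, fun _ _ => rfl, rfl⟩, ?_⟩
    simpa using hne

theorem isUnique_factor_iff {n s l : ℕ} (hl : 0 < l) (h : s + l ≤ n) :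
    IsUnique (factor 0 n) (factor s l) ↔ ¬ Rep n s l := by
  rw [← isRepeated_factor_iff hl h]
  constructor
  · rintro ⟨p, -, hp⟩ ⟨q, hq, r, hr, hne⟩
    exact hne ((hp q hq).trans (hp r hr).symm)
  · intro H
    have hs : (s + 1, s + l) ∈ occs (factor 0 n) (factor s l) :=
      (mem_occs_factor hl).2 ⟨s, h, fun _ _ => rfl, rfl⟩
    exact ⟨_, hs, fun q hq => by_contra fun hne => H ⟨q, hq, _, hs, hne⟩⟩

theorem isNetOcc_factor_iff {n : ℕ} {p : ℕ × ℕ} :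
    IsNetOcc (factor 0 n) p ↔ ∃ s l, Net n s l ∧ p = (s + 1, s + l) := by
  have key {s l : ℕ} (hl : 0 < l) (h : s + l ≤ n) :
      (IsRepeated (factor 0 n) (substr (factor 0 n) (s + 1) (s + l)) ∧
        (s + 1 = 1 ∨ IsUnique (factor 0 n) (substr (factor 0 n) (s + 1 - 1) (s + l))) ∧
        (s + l = (factor 0 n).length ∨
          IsUnique (factor 0 n) (substr (factor 0 n) (s + 1) (s + l + 1)))) ↔ Net n s l := by
    rw [substr_factor h, isRepeated_factor_iff hl h, length_factor, Net, and_iff_right (a := 0 < l ∧ s + l ≤ n) ⟨hl, h⟩]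
    refine and_congr Iff.rfl (and_congr ?_ ?_)
    · rcases s with _ | s
      · simp
      · rw [show s + 1 + 1 - 1 = s + 1 by omega, show s + 1 + l = s + (l + 1) by omega,
          substr_factor (by omega), isUnique_factor_iff (by omega) (by omega)]
        simp
    · by_cases hn : s + l = n
      · simp [hn]
      · rw [add_assoc, substr_factor (by omega), isUnique_factor_iff (by omega) (by omega)]
  rw [IsNetOcc, isOcc_factor_iff]
  constructor
  · rintro ⟨⟨s, l, hl, h, rfl⟩, H⟩
    exact ⟨s, l, (key hl h).1 H, rfl⟩
  · rintro ⟨s, l, H, rfl⟩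
    exact ⟨⟨s, l, H.1.1, H.1.2, rfl⟩, (key H.1.1 H.1.2).2 H⟩

/-! ### Reduction to the word of length 16 -/

/-- The occurrence that starts at `2 ^ k * s` and has length `2 ^ k * l`, for `p = (s, l)`. -/
def scale (k : ℕ) (p : ℕ × ℕ) : ℕ × ℕ := (2 ^ k * p.1 + 1, 2 ^ k * p.1 + 2 ^ k * p.2)

theorem scale_injective (k : ℕ) : Function.Injective (scale k) := by
  rintro ⟨a, b⟩ ⟨c, d⟩ h
  simp only [scale, Prod.mk.injEq, Nat.add_right_cancel_iff] at h
  have hk := Nat.two_pow_pos k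
  obtain rfl := Nat.eq_of_mul_eq_mul_left hk h.1
  obtain rfl := Nat.eq_of_mul_eq_mul_left hk (Nat.add_left_cancel h.2)
  rfl

theorem ncard_image_scale (k : ℕ) (F : Finset (ℕ × ℕ)) :
    (scale k '' (F : Set (ℕ × ℕ))).ncard = F.card := by
  rw [Set.ncard_image_of_injective _ (scale_injective k), Set.ncard_coe_finset]

theorem setOf_isNetOcc_tm (k : ℕ) :
    {p | IsNetOcc (tm (k + 5)) p} = scale k '' ((({(0, 4), (6, 4), (12, 4), (4, 4), (8, 4),
      (3, 3), (10, 3), (2, 3), (11, 3)} : Finset (ℕ × ℕ))) : Set (ℕ × ℕ)) := by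
  -- Pairs of start and length in abbabaabbaababba, grouped by string: abba, baab, aba, bab.
  have base : ∀ s < 17, ∀ l < 17, Net 16 s l ↔ (s, l) ∈ ({(0, 4), (6, 4), (12, 4), (4, 4), (8, 4),
      (3, 3), (10, 3), (2, 3), (11, 3)} : Finset (ℕ × ℕ)) := by decide +kernel
  have bound : ∀ p ∈ ({(0, 4), (6, 4), (12, 4), (4, 4), (8, 4),
      (3, 3), (10, 3), (2, 3), (11, 3)} : Finset (ℕ × ℕ)), p.1 < 17 ∧ p.2 < 17 := by decide
  ext p
  rw [Set.mem_ofPred_eq, tm_succ, show 2 ^ (k + 4) = 2 ^ k * 16 by ring, isNetOcc_factor_iff, Set.mem_image]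
  constructor
  · rintro ⟨s, l, H, rfl⟩
    obtain ⟨a, b, rfl, rfl, H'⟩ := net_pow.1 H
    have := H'.1
    exact ⟨(a, b), Finset.mem_coe.2 ((base a (by omega) b (by omega)).1 H'), rfl⟩
  · rintro ⟨⟨a, b⟩, H, rfl⟩
    have hb := bound _ (Finset.mem_coe.1 H)
    exact ⟨_, _, net_pow.2 ⟨a, b, rfl, rfl, (base a hb.1 b hb.2).2 (Finset.mem_coe.1 H)⟩, rfl⟩

theorem occs_tm_factor (k s l : ℕ) (hl : 2 ≤ l) :
    occs (tm (k + 5)) (factor (2 ^ k * s) (2 ^ k * l)) =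
      scale k '' ((((Finset.range 17).filter fun r => r + l ≤ 16 ∧ Match s r l).map
        ⟨fun r => (r, l), fun _ _ h => (Prod.mk.inj h).1⟩ : Finset (ℕ × ℕ)) : Set (ℕ × ℕ)) := by
  have hk := Nat.two_pow_pos k
  ext p
  rw [tm_succ, show 2 ^ (k + 4) = 2 ^ k * 16 by ring, mem_occs_factor (by positivity), Set.mem_image]
  simp only [match_pow hl, Finset.coe_map, Set.mem_image, Finset.mem_coe, Finset.mem_filter,
    Finset.mem_range]
  constructor
  · rintro ⟨_, h, ⟨a, rfl, H⟩, rfl⟩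
    have h : a + l ≤ 16 := by
      rw [← mul_add] at h
      exact Nat.le_of_mul_le_mul_left h hk
    exact ⟨_, ⟨a, ⟨by omega, h, H⟩, rfl⟩, rfl⟩
  · rintro ⟨_, ⟨a, ⟨-, h, H⟩, rfl⟩, rfl⟩
    refine ⟨_, ?_, ⟨a, rfl, H⟩, rfl⟩
    rw [← mul_add]
    exact Nat.mul_le_mul_left _ h

theorem tm_eq_factor (k : ℕ) : tm (k + 3) = factor (2 ^ k * 0) (2 ^ k * 4) := by
  rw [tm_succ, show 2 ^ (k + 2) = 2 ^ k * 4 by ring, mul_zero]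

theorem comp_tm_eq_factor (k : ℕ) : comp (tm (k + 3)) = factor (2 ^ k * 4) (2 ^ k * 4) := by
  have := factor_pow_of_true (k := k + 2) (m := 1) (by decide +kernel)
  rw [tm_succ, ← this, show 2 ^ (k + 2) = 2 ^ k * 4 by ring, mul_one]

theorem tm_append_comp_tm_eq_factor (k : ℕ) :
    tm (k + 1) ++ comp (tm (k + 2)) = factor (2 ^ k * 3) (2 ^ k * 3) := by
  have h1 := factor_pow_of_false (k := k) (m := 3) (by decide +kernel)
  have h2 := factor_pow_of_true (k := k + 1) (m := 2) (by decide +kernel)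
  rw [tm_succ, tm_succ, ← h1, ← h2, pow_succ,
    show factor (2 ^ k * 3) (2 ^ k * 3) = factor (2 ^ k * 3) (2 ^ k + 2 ^ k * 2) by congr 1; ring,
    factor_add, show 2 ^ k * 3 + 2 ^ k = 2 ^ k * 2 * 2 by ring]

/-- Position 11 serves rather than the earlier occurrence at 2, because the second piece must start
at an even multiple of `2 ^ k`: 12 is even, 3 is not. -/
theorem comp_tm_append_tm_eq_factor (k : ℕ) :
    comp (tm (k + 1)) ++ tm (k + 2) = factor (2 ^ k * 11) (2 ^ k * 3) := by
  have h1 := factor_pow_of_true (k := k) (m := 11) (by decide +kernel)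
  have h2 := factor_pow_of_false (k := k + 1) (m := 6) (by decide +kernel)
  rw [tm_succ, tm_succ, ← h1, ← h2, pow_succ,
    show factor (2 ^ k * 11) (2 ^ k * 3) = factor (2 ^ k * 11) (2 ^ k + 2 ^ k * 2) by
      congr 1; ring,
    factor_add, show 2 ^ k * 11 + 2 ^ k = 2 ^ k * 2 * 6 by ring]

end NetOcc

theorem mainTheorem2 (i : ℕ) (hi : 5 ≤ i) :
    {p : ℕ × ℕ | NetOcc.IsNetOcc (NetOcc.tm i) p} =
      {p : ℕ × ℕ | ∃ S ∈ ({NetOcc.tm (i - 2), NetOcc.comp (NetOcc.tm (i - 2)),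
          NetOcc.tm (i - 4) ++ NetOcc.comp (NetOcc.tm (i - 3)),
          NetOcc.comp (NetOcc.tm (i - 4)) ++ NetOcc.tm (i - 3)} : Set NetOcc.Word),
        p ∈ NetOcc.occs (NetOcc.tm i) S} ∧
    {p : ℕ × ℕ | NetOcc.IsNetOcc (NetOcc.tm i) p}.ncard = 9 ∧
    (NetOcc.occs (NetOcc.tm i) (NetOcc.tm (i - 2))).ncard = 3 ∧
    (NetOcc.occs (NetOcc.tm i) (NetOcc.comp (NetOcc.tm (i - 2)))).ncard = 2 ∧
    (NetOcc.occs (NetOcc.tm i)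
      (NetOcc.tm (i - 4) ++ NetOcc.comp (NetOcc.tm (i - 3)))).ncard = 2 ∧
    (NetOcc.occs (NetOcc.tm i)
      (NetOcc.comp (NetOcc.tm (i - 4)) ++ NetOcc.tm (i - 3))).ncard = 2 := by
  obtain ⟨k, rfl⟩ : ∃ k, i = k + 5 := ⟨i - 5, by omega⟩
  rw [show k + 5 - 2 = k + 3 by omega, show k + 5 - 4 = k + 1 by omega,
    show k + 5 - 3 = k + 2 by omega, NetOcc.comp_tm_eq_factor, NetOcc.tm_eq_factor k,
    NetOcc.tm_append_comp_tm_eq_factor, NetOcc.comp_tm_append_tm_eq_factor]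
  refine ⟨?_, ?_, ?_, ?_, ?_, ?_⟩
  · ext p
    simp only [Set.mem_ofPred_eq, Set.mem_insert_iff, Set.mem_singleton_iff, exists_eq_or_imp,
      exists_eq_left]
    rw [← Set.mem_ofPred_eq (p := fun p => NetOcc.IsNetOcc (NetOcc.tm (k + 5)) p),
      NetOcc.setOf_isNetOcc_tm, NetOcc.occs_tm_factor k 0 4 (by norm_num),
      NetOcc.occs_tm_factor k 4 4 (by norm_num), NetOcc.occs_tm_factor k 3 3 (by norm_num),
      NetOcc.occs_tm_factor k 11 3 (by norm_num), ← Set.mem_union, ← Set.mem_union,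
      ← Set.mem_union, ← Set.image_union, ← Set.image_union, ← Set.image_union,
      ← Finset.coe_union, ← Finset.coe_union, ← Finset.coe_union]
    -- Only an equality of explicit finite sets of pairs in the 16-letter word is left.
    apply iff_of_eq
    congr 3
  · rw [NetOcc.setOf_isNetOcc_tm, NetOcc.ncard_image_scale]
    rfl
  all_goals
    rw [NetOcc.occs_tm_factor _ _ _ (by norm_num), NetOcc.ncard_image_scale]
    decide +kernel
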